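/- Let $E$ be a finite set and let $X=(X_t)_{t\ge 0}$ be a time-homogeneous continuous-time Markov chain with values in $E$, with right-continuous sample paths, laws $(\mathbb P_x)_{x\in E}$ with $\mathbb P_x(X_0=x)=1$, and Markov generator $\mathcal Q=(Q(x,y))_{x,y\in E}$ (so $Q(x,y)\ge 0$ for $x\ne y$ and $\sum_{y}Q(x,y)=0$). For $f\in\mathbb R^E$ write $\mathcal Q[f](x)=\sum_{y\in E}Q(x,y)f(y)$. Let $\beta>0$ and let $\psi,\phi\in\mathbb R^E$ satisfy $0\le\psi\le\phi$; write $\{\phi=\psi\}=\{x\in E:\phi(x)=\psi(x)\}$. Let $\mathcal M$ be the set of all $[0,\infty]$-valued stopping times of the natural filtration of $X$, and for $\tau,\gamma\in\mathcal M$ and $x\in E$ put $$R_x(\tau,\gamma)=\mathbb E_x\big[e^{-\beta\tau}\psi(X_\tau)\mathbf 1_{\{\tau\le\gamma\}}+e^{-\beta\gamma}\phi(X_\gamma)\mathbf 1_{\{\tau>\gamma\}}\big],$$ where $e^{-\beta\eta}f(X_\eta)=0$ on $\{\eta=\infty\}$ for every $\eta\in\mathcal M$ and $f\in\mathbb R^E$.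 For $D\subseteq E$ let $h(D)=\inf\{t\ge 0: X_t\in D\}$, with $\inf\emptyset=\infty$. Let $A,B\subseteq E$ be disjoint sets, each disjoint from $\{\phi=\psi\}$, and let $\widetilde V\in\mathbb R^E$ satisfy: - $\mathcal Q[\widetilde V](x)-\beta\widetilde V(x)\le 0$ and $\widetilde V(x)=\psi(x)$ for all $x\in A$; - $\mathcal Q[\widetilde V](x)-\beta\widetilde V(x)\ge 0$ and $\widetilde V(x)=\phi(x)$ for all $x\in B$; - $\mathcal Q[\widetilde V](x)-\beta\widetilde V(x)=0$ for all $x\notin A\cup B\cup\{\phi=\psi\}$; - $\psi(x)\le\widetilde V(x)\le\phi(x)$ for all $x\in E$. Then, with $\tau^*=h(A\cup\{\phi=\psi\})$ and $\gamma^*=h(B\cup\{\phi=\psi\})$, the pair $(\tau^*,\gamma^*)$ is a Nash equilibrium, i.e. $\tau^*,\gamma^*\in\mathcal M$ and $$R_x(\tau,\gamma^*)\le R_x(\tau^*,\gamma^*)\le R_x(\tau^*,\gamma)\qquad\text{for all }x\in E\text{ and all }\tau,\gamma\in\mathcal M.$$ Moreover the game has a value and $\widetilde V$ is its value function: $$\sup_{\tau\in\mathcal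 M}\inf_{\gamma\in\mathcal M}R_x(\tau,\gamma)=\inf_{\gamma\in\mathcal M}\sup_{\tau\in\mathcal M}R_x(\tau,\gamma)=\widetilde V(x)\qquad\text{for all }x\in E.$$ -/

import Mathlib

open MeasureTheory ProbabilityTheory Set Filter Topology
open scoped NNReal

noncomputable section

namespace StoppingGame

/-- A Markov generator on a finite set: nonnegative off-diagonal entries and zero row sums. -/
structure IsMarkovGenerator {E : Type*} [Fintype E] (Q : Matrix E E ℝ) : Prop where
  row_sum : ∀ x, ∑ y, Q x y = 0
  off_diag_nonneg : ∀ x y, x ≠ y → 0 ≤ Q x y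

/-- A time-homogeneous continuous-time Markov chain with values in the finite discrete space `E`,
with right-continuous paths and generator `Q`: a process `X` on a measurable space `Ω`, with a
family of laws `P x`, one for each starting point `x`. -/
structure MarkovChain (E Ω : Type*) [Fintype E] [TopologicalSpace E] [DiscreteTopology E]
    [MeasurableSpace E] [BorelSpace E] [MeasurableSpace Ω] (Q : Matrix E E ℝ) where
  /-- The state at time `t`. -/
  X : ℝ≥0 → Ω → E
  /-- The law of the chain started at `x`. -/
  P : E → Measure Ω
  isProbabilityMeasure : ∀ x, IsProbabilityMeasure (P x)
  measurable_X : ∀ t, Measurable (X t)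
  right_continuous : ∀ ω t, ContinuousWithinAt (fun s => X s ω) (Ici t) t
  start : ∀ x, P x {ω | X 0 ω = x} = 1
  /-- The (homogeneous) Markov property with respect to the natural filtration:
  `P_x(X_{s+t} = y | F_s) = P_{X_s}(X_t = y)` almost surely. -/
  markov : ∀ (x y : E) (s t : ℝ≥0),
    (P x)[({ω | X (s + t) ω = y}).indicator (fun _ => (1 : ℝ)) |
        Filtration.natural X (fun r => (measurable_X r).stronglyMeasurable) s]
      =ᵐ[P x] fun ω => (P (X s ω)).real {ω' | X t ω' = y}
  /-- `Q` is the generator: the right derivative at time `0` of the transition probabilities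
  `t ↦ P_x(X_t = y)`. -/
  generator : ∀ x y : E,
    HasDerivWithinAt (fun t : ℝ => (P x).real {ω | X t.toNNReal ω = y}) (Q x y) (Ici 0) 0

variable {E Ω : Type*} [Fintype E] [TopologicalSpace E] [DiscreteTopology E]
  [MeasurableSpace E] [BorelSpace E] [mΩ : MeasurableSpace Ω] {Q : Matrix E E ℝ}

namespace MarkovChain

/-- The natural filtration `F_t = σ(X_s, s ≤ t)`. -/
def filtration (M : MarkovChain E Ω Q) : Filtration ℝ≥0 mΩ :=
  Filtration.natural M.X (fun t => (M.measurable_X t).stronglyMeasurable)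

/-- Stopping times of the natural filtration, with values in `[0, ∞]`. -/
def IsStopping (M : MarkovChain E Ω Q) (τ : Ω → WithTop ℝ≥0) : Prop :=
  IsStoppingTime M.filtration τ

/-- The first hitting time `h(A) = inf {t ≥ 0 | X_t ∈ A}`, equal to `⊤` if `A` is never hit. -/
def hit (M : MarkovChain E Ω Q) (A : Set E) : Ω → WithTop ℝ≥0 :=
  hittingAfter M.X A 0

open Classical in
/-- `e^{-β η} f(X_η)`, with the convention that it is `0` where `η = ∞`. -/
def discounted (M : MarkovChain E Ω Q) (β : ℝ) (f : E → ℝ) (η : Ω → WithTop ℝ≥0) (ω : Ω) : ℝ :=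
  if η ω = ⊤ then 0
  else Real.exp (-β * ((η ω).untopD 0 : ℝ≥0)) * f (M.X ((η ω).untopD 0) ω)

open Classical in
/-- The expected payoff
`R_x(τ, γ) = E_x[e^{-βτ} ψ(X_τ) 1_{τ ≤ γ} + e^{-βγ} φ(X_γ) 1_{τ > γ}]`. -/
def payoff (M : MarkovChain E Ω Q) (β : ℝ) (ψ φ : E → ℝ) (x : E)
    (τ γ : Ω → WithTop ℝ≥0) : ℝ :=
  ∫ ω, (if τ ω ≤ γ ω then M.discounted β ψ τ ω else M.discounted β φ γ ω) ∂(M.P x)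

/-- The lower value `sup_τ inf_γ R_x(τ, γ)` over stopping times, taken in the extended reals. -/
def lowerValue (M : MarkovChain E Ω Q) (β : ℝ) (ψ φ : E → ℝ) (x : E) : EReal :=
  ⨆ (τ : Ω → WithTop ℝ≥0) (_ : M.IsStopping τ),
    ⨅ (γ : Ω → WithTop ℝ≥0) (_ : M.IsStopping γ), (M.payoff β ψ φ x τ γ : EReal)

/-- The upper value `inf_γ sup_τ R_x(τ, γ)` over stopping times, taken in the extended reals. -/
def upperValue (M : MarkovChain E Ω Q) (β : ℝ) (ψ φ : E → ℝ) (x : E) : EReal :=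
  ⨅ (γ : Ω → WithTop ℝ≥0) (_ : M.IsStopping γ),
    ⨆ (τ : Ω → WithTop ℝ≥0) (_ : M.IsStopping τ), (M.payoff β ψ φ x τ γ : EReal)

/-- The game has a value, and `V` is its value function: lower and upper value both equal `V`. -/
def IsValueFunction (M : MarkovChain E Ω Q) (β : ℝ) (ψ φ V : E → ℝ) : Prop :=
  ∀ x, M.lowerValue β ψ φ x = (V x : EReal) ∧ M.upperValue β ψ φ x = (V x : EReal)

/-- `(τ', γ')` is a Nash equilibrium: both are stopping times, and
`R_x(τ, γ') ≤ R_x(τ', γ') ≤ R_x(τ', γ)` for all starting points and all stopping times. -/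
def IsNashEquilibrium (M : MarkovChain E Ω Q) (β : ℝ) (ψ φ : E → ℝ)
    (τ' γ' : Ω → WithTop ℝ≥0) : Prop :=
  M.IsStopping τ' ∧ M.IsStopping γ' ∧
    ∀ x, ∀ τ γ : Ω → WithTop ℝ≥0, M.IsStopping τ → M.IsStopping γ →
      M.payoff β ψ φ x τ γ' ≤ M.payoff β ψ φ x τ' γ' ∧
      M.payoff β ψ φ x τ' γ' ≤ M.payoff β ψ φ x τ' γ

end MarkovChain

/-- `Q[f](x) = ∑ y, Q(x, y) f(y)`. -/
def genApply {E : Type*} [Fintype E] (Q : Matrix E E ℝ) (f : E → ℝ) (x : E) : ℝ :=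
  ∑ y, Q x y * f y

end StoppingGame

end

noncomputable section

namespace StoppingGame
namespace MarkovChain

variable {E Ω : Type*} [Fintype E] [TopologicalSpace E] [DiscreteTopology E]
  [MeasurableSpace E] [BorelSpace E] [mΩ : MeasurableSpace Ω] {Q : Matrix E E ℝ}

/-! ### Paths and hitting times -/

/-! The discounted process `e^{-βt} W(X_t)` is a supermartingale until the chain enters `B ∪ {φ =
ψ}` and a submartingale until it enters `A ∪ {φ = ψ}`. If the minimiser stops on entering the first
set, where `W = φ`, then `ψ ≤ W` and optional stopping at `min τ γ*` bound the payoff above by `W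
x`, whatever `τ` is (`payoff_hit_right_le`). The lower bound is symmetric (`le_payoff_hit_left`).
Two such guarantees at the same level `W` give both the equilibrium and the value.

The analytic core is the optional stopping inequality `integral_discounted_le`. The stopping time is
rounded up to a finite grid, and the stopped process is telescoped along it. The Markov property at
deterministic times and the derivative of the semigroup at `0` control each increment. Refining the
grid and extending its horizon yields the claim by dominated convergence. -/

lemma eventually_X_eq (M : MarkovChain E Ω Q) (ω : Ω) (t : ℝ≥0) :
    ∀ᶠ s in 𝓝[≥] t, M.X s ω = M.X t ω :=
  (M.right_continuous ω t).eventually (p := fun y => y = M.X t ω) (by simp [nhds_discrete])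

lemma measurable_comp_X (M : MarkovChain E Ω Q) (F : E → ℝ) (t : ℝ≥0) :
    Measurable fun ω => F (M.X t ω) :=
  (measurable_of_finite F).comp (M.measurable_X t)

lemma measurableSet_X_mem (M : MarkovChain E Ω Q) {s t : ℝ≥0} (hst : s ≤ t) (D : Set E) :
    MeasurableSet[M.filtration t] {ω | M.X s ω ∈ D} := by
  have h : MeasurableSet[M.filtration s] {ω | M.X s ω ∈ D} := by
    have hle : MeasurableSpace.comap (M.X s) inferInstance ≤ M.filtration s :=
      le_iSup₂_of_le s le_rfl (le_of_eq (by congr 1))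
    exact hle _ ⟨D, D.toFinite.measurableSet, rfl⟩
  exact M.filtration.mono hst _ h

/-- The infimum is attained: a right-continuous path in a discrete space is constant just after `t`,
and `D` is visited at times arbitrarily close to the infimum from the right. -/
lemma X_hit_mem (M : MarkovChain E Ω Q) (D : Set E) {ω : Ω} {t : ℝ≥0} (h : M.hit D ω = t) :
    M.X t ω ∈ D := by
  have hne : M.hit D ω ≠ ⊤ := h ▸ WithTop.coe_ne_top
  have hex : ∃ j, 0 ≤ j ∧ M.X j ω ∈ D := by
    simpa only [hit, ne_eq, hittingAfter_eq_top_iff, not_forall, not_not, exists_prop] using hne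
  have ht : sInf {i : ℝ≥0 | 0 ≤ i ∧ M.X i ω ∈ D} = t := by
    rw [hit, hittingAfter, if_pos hex] at h
    exact_mod_cast h
  obtain ⟨u, hu, hX⟩ := mem_nhdsGE_iff_exists_Ico_subset.1 (M.eventually_X_eq ω t)
  obtain ⟨i, hi, hiu⟩ := exists_lt_of_csInf_lt hex (ht.trans_lt hu)
  have hti : t ≤ i := ht ▸ csInf_le (OrderBot.bddBelow _) hi
  have : M.X i ω = M.X t ω := hX ⟨hti, hiu⟩
  exact this ▸ hi.2

lemma X_notMem_of_lt_hit (M : MarkovChain E Ω Q) (D : Set E) {ω : Ω} {t : ℝ≥0}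
    (h : (t : WithTop ℝ≥0) < M.hit D ω) : M.X t ω ∉ D :=
  notMem_of_lt_hittingAfter h zero_le

lemma hit_le_iff (M : MarkovChain E Ω Q) (D : Set E) (ω : Ω) (t : ℝ≥0) :
    M.hit D ω ≤ t ↔ ∃ s ≤ t, M.X s ω ∈ D := by
  constructor
  · intro h
    have hne : M.hit D ω ≠ ⊤ := fun h' => WithTop.not_top_le_coe t (h' ▸ h)
    obtain ⟨s, hs⟩ := WithTop.ne_top_iff_exists.1 hne
    refine ⟨s, ?_, M.X_hit_mem D hs.symm⟩
    rw [← hs] at h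
    exact_mod_cast h
  · rintro ⟨s, hst, hs⟩
    exact (hittingAfter_le_of_mem zero_le hs).trans (by exact_mod_cast hst)

lemma isStopping_hit (M : MarkovChain E Ω Q) (D : Set E) : M.IsStopping (M.hit D) := by
  intro t
  obtain ⟨c, hc, hcd⟩ := TopologicalSpace.exists_countable_dense ℝ≥0
  -- A visit at `s < t` persists up to some point of the dense set before `t`; a visit at `t` itself
  -- leaves no such room, so `t` is added by hand.
  have h : {ω | M.hit D ω ≤ t} =
      ⋃ s ∈ insert t (c ∩ Iic t), {ω | M.X s ω ∈ D} := by
    ext ω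
    simp only [mem_ofPred_eq, hit_le_iff, mem_iUnion, exists_prop]
    constructor
    · rintro ⟨s, hst, hs⟩
      obtain rfl | hlt := hst.eq_or_lt
      · exact ⟨s, mem_insert _ _, hs⟩
      obtain ⟨u, hu, hX⟩ := mem_nhdsGE_iff_exists_Ico_subset.1 (M.eventually_X_eq ω s)
      obtain ⟨r, hrc, hr⟩ := hcd.exists_between (lt_min hu hlt)
      refine ⟨r, mem_insert_of_mem _ ⟨hrc, (hr.2.trans_le (min_le_right _ _)).le⟩, ?_⟩
      have : M.X r ω = M.X s ω := hX ⟨hr.1.le, hr.2.trans_le (min_le_left _ _)⟩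
      exact this ▸ hs
    · rintro ⟨s, rfl | hs, hsD⟩
      · exact ⟨s, le_rfl, hsD⟩
      · exact ⟨s, hs.2, hsD⟩
  rw [h]
  refine MeasurableSet.biUnion ((hc.mono inter_subset_left).insert t) fun s hs => ?_
  refine M.measurableSet_X_mem ?_ D
  rcases hs with rfl | hs
  exacts [le_rfl, hs.2]

/-! ### The transition semigroup -/

/-- The transition operator `T_t F (y) = E_y[F(X_t)]`. -/
def transition (M : MarkovChain E Ω Q) (t : ℝ≥0) (F : E → ℝ) (y : E) : ℝ :=
  ∑ z, (M.P y).real {ω | M.X t ω = z} * F z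

lemma X_zero_ae (M : MarkovChain E Ω Q) (x : E) : ∀ᵐ ω ∂(M.P x), M.X 0 ω = x := by
  have := M.isProbabilityMeasure x
  have hm : MeasurableSet {ω | M.X 0 ω = x} := M.measurable_X 0 (measurableSet_singleton x)
  exact (prob_compl_eq_zero_iff hm).2 (M.start x)

lemma transition_zero (M : MarkovChain E Ω Q) (F : E → ℝ) (y : E) :
    M.transition 0 F y = F y := by
  classical
  have := M.isProbabilityMeasure y
  have h (z : E) : (M.P y).real {ω | M.X 0 ω = z} = if z = y then 1 else 0 := by
    split_ifs with hz
    · subst hz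
      simp [measureReal_def, M.start]
    · have : M.P y {ω | M.X 0 ω = z} = 0 := by
        refine measure_mono_null (fun ω hω => ?_) (M.X_zero_ae y)
        simp only [mem_ofPred_eq, mem_compl_iff] at hω ⊢
        exact fun h => hz (hω.symm.trans h)
      simp [measureReal_def, this]
  simp [transition, h]

lemma hasDerivWithinAt_transition (M : MarkovChain E Ω Q) (F : E → ℝ) (y : E) :
    HasDerivWithinAt (fun t : ℝ => M.transition t.toNNReal F y) (genApply Q F y) (Ici 0) 0 := by
  unfold transition genApply
  exact HasDerivWithinAt.fun_sum fun z _ => (M.generator y z).mul_const (F z)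

/-- Infinitesimal drift: if `(Q - β)F(y) ≤ 0`, then one small discounted step of the semigroup
raises `F` at `y` by at most an arbitrarily small multiple of `1 - e^{-βδ}`. -/
lemma eventually_discounted_transition_le (M : MarkovChain E Ω Q) {β : ℝ} (hβ : 0 < β)
    (F : E → ℝ) {y : E} (hy : genApply Q F y - β * F y ≤ 0) {ε : ℝ} (hε : 0 < ε) :
    ∀ᶠ t : ℝ in 𝓝[>] 0, Real.exp (-β * t) * M.transition t.toNNReal F y - F y
      ≤ ε * (1 - Real.exp (-β * t)) := by
  have hexp : HasDerivWithinAt (fun t : ℝ => Real.exp (-β * t)) (-β) (Ici 0) 0 := by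
    have := ((hasDerivAt_id (0 : ℝ)).const_mul (-β)).exp.hasDerivWithinAt (s := Ici 0)
    simpa using this
  -- The extra term `ε e^{-βt}` contributes `-εβ`, so the derivative at `0` is strictly negative
  -- even when `(Q - β)F(y) = 0`.
  have hu := (hexp.mul (M.hasDerivWithinAt_transition F y)).add (hexp.const_mul ε)
  have hslope := hasDerivWithinAt_iff_tendsto_slope.1 hu
  have hneg := hslope.eventually_lt_const (u := 0) (by
    simp only [mul_zero, Real.exp_zero, Real.toNNReal_zero, transition_zero]
    nlinarith)
  rw [Ici_sdiff_left] at hneg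
  filter_upwards [hneg, self_mem_nhdsWithin] with t ht ht0
  simp only [slope_def_field, Pi.add_apply, Pi.mul_apply, mul_zero, Real.exp_zero,
    Real.toNNReal_zero, transition_zero, sub_zero] at ht
  have := (div_neg_iff.1 ht).resolve_left (fun h => absurd ht0 (not_lt.2 h.2.le))
  linarith [this.1]

/-- The Markov property for functions of the state, integrated over an event of the past. -/
lemma setIntegral_comp_X_add (M : MarkovChain E Ω Q) (x : E) (F : E → ℝ) (s t : ℝ≥0) {S : Set Ω}
    (hS : MeasurableSet[M.filtration s] S) :
    ∫ ω in S, F (M.X (s + t) ω) ∂(M.P x) = ∫ ω in S, M.transition t F (M.X s ω) ∂(M.P x) := by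
  classical
  have := M.isProbabilityMeasure x
  have hm (z : E) : MeasurableSet {ω | M.X (s + t) ω = z} :=
    M.measurable_X _ (measurableSet_singleton z)
  have hone (z : E) : ∫ ω in S, ({ω | M.X (s + t) ω = z}).indicator (fun _ => (1 : ℝ)) ω ∂(M.P x)
      = ∫ ω in S, (M.P (M.X s ω)).real {ω' | M.X t ω' = z} ∂(M.P x) := by
    rw [← setIntegral_condExp (M.filtration.le s) ((integrable_const _).indicator (hm z)) hS]
    exact integral_congr_ae (ae_restrict_of_ae (M.markov x z s t))
  have hF (ω : Ω) : F (M.X (s + t) ω) =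
      ∑ z, ({ω | M.X (s + t) ω = z}).indicator (fun _ => (1 : ℝ)) ω * F z := by
    simp [indicator_apply]
  simp_rw [hF, transition]
  rw [integral_finsetSum _ fun z _ => ?_, integral_finsetSum _ fun z _ => ?_]
  · simp_rw [integral_mul_const, hone]
  · refine Integrable.mul_const (Integrable.of_bound (C := 1) ?_ ?_) _
    · exact (M.measurable_comp_X (fun y => (M.P y).real {ω' | M.X t ω' = z}) s).aestronglyMeasurable
    · refine ae_of_all _ fun ω => ?_
      have := M.isProbabilityMeasure (M.X s ω)
      rw [Real.norm_of_nonneg measureReal_nonneg]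
      exact measureReal_le_one
  · exact (((integrable_const _).indicator (hm z)).mul_const _).integrableOn

/-! ### Discretisation of a stopped discounted process -/

/-- The discounted reward `e^{-βt} F(X_t)` at a fixed time. -/
def discountedAt (M : MarkovChain E Ω Q) (β : ℝ) (F : E → ℝ) (t : ℝ≥0) (ω : Ω) : ℝ :=
  Real.exp (-β * t) * F (M.X t ω)

lemma measurable_discountedAt (M : MarkovChain E Ω Q) (β : ℝ) (F : E → ℝ) (t : ℝ≥0) :
    Measurable (M.discountedAt β F t) :=
  (M.measurable_comp_X F t).const_mul _

lemma abs_discountedAt_le (M : MarkovChain E Ω Q) (β : ℝ) (F : E → ℝ) (t : ℝ≥0)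
    (ω : Ω) : |M.discountedAt β F t ω| ≤ Real.exp (-β * t) * ∑ y, |F y| := by
  rw [discountedAt, abs_mul, Real.abs_exp]
  gcongr
  exact Finset.single_le_sum (f := fun y => |F y|) (fun _ _ => abs_nonneg _) (Finset.mem_univ _)

lemma abs_discountedAt_le_sum (M : MarkovChain E Ω Q) {β : ℝ} (hβ : 0 < β) (F : E → ℝ) (t : ℝ≥0)
    (ω : Ω) : |M.discountedAt β F t ω| ≤ ∑ y, |F y| := by
  refine (M.abs_discountedAt_le β F t ω).trans
    (mul_le_of_le_one_left (Finset.sum_nonneg fun _ _ => abs_nonneg _) (Real.exp_le_one_iff.2 ?_))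
  have : 0 ≤ β * t := by positivity
  linarith

lemma integrable_discountedAt (M : MarkovChain E Ω Q) {β : ℝ} (hβ : 0 < β) (F : E → ℝ) (t : ℝ≥0)
    (x : E) : Integrable (M.discountedAt β F t) (M.P x) := by
  have := M.isProbabilityMeasure x
  exact Integrable.of_bound (M.measurable_discountedAt β F t).aestronglyMeasurable _
    (ae_of_all _ fun ω => M.abs_discountedAt_le_sum hβ F t ω)

/-- The discounted process stopped at the first of the grid points `0, δ, …, Nδ` which is at
least `σ` (at `Nδ` if there is none), written as a telescoping sum. -/
def gridStopped (M : MarkovChain E Ω Q) (β : ℝ) (F : E → ℝ) (σ : Ω → WithTop ℝ≥0) (δ : ℝ≥0) (N : ℕ)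
    (ω : Ω) : ℝ :=
  M.discountedAt β F 0 ω + ∑ k ∈ Finset.range N,
    ({ω | ((k * δ : ℝ≥0) : WithTop ℝ≥0) < σ ω}).indicator
      (fun ω => M.discountedAt β F (k * δ + δ) ω - M.discountedAt β F (k * δ) ω) ω

/-- Here `m` is the index of the first grid point at or after `σ`, capped at `N`; the indicators cut
the telescoping sum there. -/
lemma gridStopped_eq (M : MarkovChain E Ω Q) (β : ℝ) (F : E → ℝ) (σ : Ω → WithTop ℝ≥0) (δ : ℝ≥0)
    {N m : ℕ} {ω : Ω} (hm : m ≤ N)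
    (h : ∀ k < N, ((k * δ : ℝ≥0) : WithTop ℝ≥0) < σ ω ↔ k < m) :
    M.gridStopped β F σ δ N ω = M.discountedAt β F (m * δ) ω := by
  classical
  have hsum : ∑ k ∈ Finset.range N, ({ω | ((k * δ : ℝ≥0) : WithTop ℝ≥0) < σ ω}).indicator
      (fun ω => M.discountedAt β F (k * δ + δ) ω - M.discountedAt β F (k * δ) ω) ω =
      ∑ k ∈ Finset.range m,
        (M.discountedAt β F ((k + 1 : ℕ) * δ) ω - M.discountedAt β F (k * δ) ω) := by
    rw [← Finset.sum_subset (Finset.range_mono hm)]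
    · refine Finset.sum_congr rfl fun k hk => ?_
      have hk := Finset.mem_range.1 hk
      rw [indicator_of_mem]
      · push_cast
        rw [add_mul, one_mul]
      · exact (h k (hk.trans_le hm)).2 hk
    · intro k hk hk'
      rw [Finset.mem_range] at hk hk'
      rw [indicator_of_notMem]
      exact fun hω => hk' ((h k hk).1 hω)
  rw [gridStopped, hsum, Finset.sum_range_sub (fun k : ℕ => M.discountedAt β F (k * δ) ω)]
  simp

lemma gridStopped_of_top (M : MarkovChain E Ω Q) (β : ℝ) (F : E → ℝ) {σ : Ω → WithTop ℝ≥0}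
    (δ : ℝ≥0) (N : ℕ) {ω : Ω} (h : σ ω = ⊤) :
    M.gridStopped β F σ δ N ω = M.discountedAt β F (N * δ) ω :=
  M.gridStopped_eq β F σ δ le_rfl fun k hk => by simp only [h, hk, WithTop.coe_lt_top]

lemma gridStopped_of_eq (M : MarkovChain E Ω Q) (β : ℝ) (F : E → ℝ) {σ : Ω → WithTop ℝ≥0}
    {δ : ℝ≥0} (hδ : 0 < δ) (N : ℕ) {ω : Ω} {s : ℝ≥0} (h : σ ω = s) :
    M.gridStopped β F σ δ N ω = M.discountedAt β F ((min N ⌈s / δ⌉₊ : ℕ) * δ) ω :=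
  M.gridStopped_eq β F σ δ (min_le_left _ _) fun k hk => by
    rw [h, WithTop.coe_lt_coe, lt_min_iff, Nat.lt_ceil, lt_div_iff₀ hδ]
    simp [hk]

lemma abs_gridStopped_le (M : MarkovChain E Ω Q) {β : ℝ} (hβ : 0 < β) (F : E → ℝ)
    (σ : Ω → WithTop ℝ≥0) {δ : ℝ≥0} (hδ : 0 < δ) (N : ℕ) (ω : Ω) :
    |M.gridStopped β F σ δ N ω| ≤ ∑ y, |F y| := by
  rcases h : σ ω with _ | s
  · rw [M.gridStopped_of_top β F δ N h]
    exact M.abs_discountedAt_le_sum hβ F _ ω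
  · rw [M.gridStopped_of_eq β F hδ N h]
    exact M.abs_discountedAt_le_sum hβ F _ ω

lemma measurable_gridStopped (M : MarkovChain E Ω Q) (β : ℝ) (F : E → ℝ)
    {σ : Ω → WithTop ℝ≥0} (hσ : M.IsStopping σ) (δ : ℝ≥0) (N : ℕ) :
    Measurable (M.gridStopped β F σ δ N) := by
  refine (M.measurable_discountedAt β F 0).add (Finset.measurable_fun_sum _ fun k _ => ?_)
  refine ((M.measurable_discountedAt β F _).sub (M.measurable_discountedAt β F _)).indicator ?_
  exact M.filtration.le _ _ (hσ.measurableSet_gt (k * δ))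

/-- The mesh `1/(n+1)` of the `n`-th grid. -/
def mesh (n : ℕ) : ℝ≥0 := ((n : ℝ≥0) + 1)⁻¹

lemma mesh_pos (n : ℕ) : 0 < mesh n := by unfold mesh; positivity

lemma tendsto_mesh : Tendsto (fun n => (mesh n : ℝ)) atTop (𝓝[>] 0) := by
  refine tendsto_nhdsWithin_iff.2 ⟨?_, Eventually.of_forall fun n => by exact_mod_cast mesh_pos n⟩
  simpa [mesh] using tendsto_one_div_add_atTop_nhds_zero_nat (𝕜 := ℝ)

/-- With mesh `1/(n+1)` and `(n+1)^2` steps the horizon is `n+1`. Where `σ = ∞`, discounting at the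
horizon forces the limit `0`; where `σ = s`, the rounded times approach `s` from the right and the
state is eventually `X_s`. -/
lemma tendsto_gridStopped (M : MarkovChain E Ω Q) {β : ℝ} (hβ : 0 < β) (F : E → ℝ)
    (σ : Ω → WithTop ℝ≥0) (ω : Ω) :
    Tendsto (fun n : ℕ => M.gridStopped β F σ (mesh n) ((n + 1) ^ 2) ω) atTop
      (𝓝 (M.discounted β F σ ω)) := by
  rcases h : σ ω with _ | s
  · have h : σ ω = ⊤ := h
    simp only [discounted, h, if_true]
    have hN (n : ℕ) : (((n + 1) ^ 2 : ℕ) : ℝ≥0) * mesh n = n + 1 := by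
      have : (n : ℝ≥0) + 1 ≠ 0 := by positivity
      push_cast [mesh]
      field_simp
    simp_rw [M.gridStopped_of_top β F _ _ h, hN]
    refine squeeze_zero_norm (fun n => M.abs_discountedAt_le β F _ ω) ?_
    rw [← zero_mul (∑ y, |F y|)]
    refine Tendsto.mul_const _ (Real.tendsto_exp_atBot.comp ?_)
    push_cast
    exact (tendsto_atTop_add_const_right _ 1 tendsto_natCast_atTop_atTop).const_mul_atTop_of_neg
      (neg_lt_zero.2 hβ)
  · have h : σ ω = (s : WithTop ℝ≥0) := h
    have hne : (s : WithTop ℝ≥0) ≠ ⊤ := WithTop.coe_ne_top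
    have hd : M.discounted β F σ ω = M.discountedAt β F s ω := by
      rw [discounted, discountedAt, h, if_neg hne, WithTop.untopD_coe]
    rw [hd]
    set r : ℕ → ℝ≥0 := fun n => (⌈s / mesh n⌉₊ : ℝ≥0) * mesh n with hr
    have hle (n : ℕ) : s ≤ r n := by
      rw [hr]
      exact (div_le_iff₀ (mesh_pos n)).1 (Nat.le_ceil _)
    have hge (n : ℕ) : r n ≤ s + mesh n := by
      have := (Nat.ceil_lt_add_one (zero_le (a := s / mesh n))).le
      calc r n ≤ (s / mesh n + 1) * mesh n := by simp only [hr]; gcongr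
        _ = s + mesh n := by rw [add_mul, one_mul, div_mul_cancel₀ _ (mesh_pos n).ne']
    have hmesh : Tendsto mesh atTop (𝓝 0) :=
      NNReal.tendsto_coe.1 (tendsto_mesh.mono_right nhdsWithin_le_nhds)
    have hrlim : Tendsto r atTop (𝓝[≥] s) := by
      refine tendsto_nhdsWithin_iff.2 ⟨?_, Eventually.of_forall hle⟩
      exact tendsto_of_tendsto_of_tendsto_of_le_of_le tendsto_const_nhds
        (by simpa using hmesh.const_add s) hle hge
    have hev : ∀ᶠ n : ℕ in atTop, M.gridStopped β F σ (mesh n) ((n + 1) ^ 2) ω =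
        Real.exp (-β * r n) * F (M.X s ω) := by
      obtain ⟨K, hK⟩ := exists_nat_ge s
      filter_upwards [hrlim.eventually (M.eventually_X_eq ω s), eventually_ge_atTop K]
        with n hn hnK
      rw [M.gridStopped_of_eq β F (mesh_pos n) _ h, min_eq_right, ← hn, discountedAt]
      rw [Nat.ceil_le, div_le_iff₀ (mesh_pos n)]
      have hn0 : (n : ℝ≥0) + 1 ≠ 0 := by positivity
      have : (((n + 1) ^ 2 : ℕ) : ℝ≥0) * mesh n = n + 1 := by
        push_cast [mesh]
        field_simp
      rw [this]
      have : (K : ℝ≥0) ≤ n := by exact_mod_cast hnK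
      exact hK.trans (this.trans (by simp))
    refine Tendsto.congr' (hev.mono fun _ => Eq.symm) ?_
    refine Tendsto.mul_const _ (Real.continuous_exp.continuousAt.tendsto.comp ?_)
    exact (NNReal.tendsto_coe.2 (hrlim.mono_right nhdsWithin_le_nhds)).const_mul _

lemma measurable_discounted (M : MarkovChain E Ω Q) {β : ℝ} (hβ : 0 < β) (F : E → ℝ)
    {σ : Ω → WithTop ℝ≥0} (hσ : M.IsStopping σ) : Measurable (M.discounted β F σ) :=
  measurable_of_tendsto_metrizable (fun n => M.measurable_gridStopped β F hσ (mesh n) _)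
    (tendsto_pi_nhds.2 (M.tendsto_gridStopped hβ F σ))

lemma abs_discounted_le (M : MarkovChain E Ω Q) {β : ℝ} (hβ : 0 < β) (F : E → ℝ)
    (σ : Ω → WithTop ℝ≥0) (ω : Ω) : |M.discounted β F σ ω| ≤ ∑ y, |F y| :=
  le_of_tendsto (M.tendsto_gridStopped hβ F σ ω).abs
    (Eventually.of_forall fun n => M.abs_gridStopped_le hβ F σ (mesh_pos n) _ ω)

/-! ### Optional stopping -/

/-- Since `{kδ < σ}` belongs to `F_{kδ}`, the Markov property applies to each increment. Errors of
the form `ε(1 - e^{-βδ})`, discounted by `e^{-βkδ}`, telescope to at most `ε`, uniformly in `δ` and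
`N`. -/
lemma integral_gridStopped_le (M : MarkovChain E Ω Q) {β : ℝ} (hβ : 0 < β) (F : E → ℝ)
    {σ : Ω → WithTop ℝ≥0} (hσ : M.IsStopping σ) {D : Set E}
    (hD : ∀ ω (s : ℝ≥0), (s : WithTop ℝ≥0) < σ ω → M.X s ω ∉ D) {ε : ℝ} (hε : 0 ≤ ε) {δ : ℝ≥0}
    (hδ : ∀ y ∉ D, Real.exp (-β * δ) * M.transition δ F y - F y ≤ ε * (1 - Real.exp (-β * δ)))
    (N : ℕ) (x : E) :
    ∫ ω, M.gridStopped β F σ δ N ω ∂(M.P x) ≤ F x + ε := by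
  have := M.isProbabilityMeasure x
  set r := Real.exp (-β * δ) with hr
  have hr1 : r ≤ 1 := Real.exp_le_one_iff.2 (by
    have : 0 ≤ β * δ := by positivity
    linarith)
  have hexp (k : ℕ) : Real.exp (-β * ((k * δ : ℝ≥0) : ℝ)) = r ^ k := by
    rw [hr, ← Real.exp_nat_mul]; push_cast; ring_nf
  have hexp' (k : ℕ) : Real.exp (-β * ((k * δ + δ : ℝ≥0) : ℝ)) = r ^ k * r := by
    rw [← hexp, hr, ← Real.exp_add]; push_cast; ring_nf
  have hmeas (k : ℕ) : MeasurableSet[M.filtration (k * δ)]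
      {ω | ((k * δ : ℝ≥0) : WithTop ℝ≥0) < σ ω} := hσ.measurableSet_gt (k * δ)
  have hmeas' (k : ℕ) := M.filtration.le _ _ (hmeas k)
  have hint (k : ℕ) : Integrable (({ω | ((k * δ : ℝ≥0) : WithTop ℝ≥0) < σ ω}).indicator
      (fun ω => M.discountedAt β F (k * δ + δ) ω - M.discountedAt β F (k * δ) ω)) (M.P x) :=
    ((M.integrable_discountedAt hβ F _ x).sub (M.integrable_discountedAt hβ F _ x)).indicator
      (hmeas' k)
  have hbound (G : E → ℝ) (t : ℝ≥0) : Integrable (fun ω => G (M.X t ω)) (M.P x) := by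
    refine Integrable.of_bound (C := ∑ y, |G y|) (M.measurable_comp_X G t).aestronglyMeasurable
      (ae_of_all _ fun ω => ?_)
    exact Finset.single_le_sum (f := fun y => |G y|) (fun _ _ => abs_nonneg _) (Finset.mem_univ _)
  have hstep (k : ℕ) : ∫ ω, ({ω | ((k * δ : ℝ≥0) : WithTop ℝ≥0) < σ ω}).indicator
      (fun ω => M.discountedAt β F (k * δ + δ) ω - M.discountedAt β F (k * δ) ω) ω ∂(M.P x)
      ≤ ε * (r ^ k - r ^ (k + 1)) := by
    rw [integral_indicator (hmeas' k), integral_sub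
      (M.integrable_discountedAt hβ F _ x).integrableOn
      (M.integrable_discountedAt hβ F _ x).integrableOn]
    simp only [discountedAt, hexp, hexp', integral_const_mul]
    rw [M.setIntegral_comp_X_add x F _ _ (hmeas k), ← integral_const_mul, ← integral_const_mul,
      ← integral_sub ((hbound _ _).integrableOn.const_mul _) ((hbound F _).integrableOn.const_mul _),
      ← integral_indicator (hmeas' k)]
    have hc : ε * (r ^ k - r ^ (k + 1)) = ∫ _, ε * (r ^ k - r ^ (k + 1)) ∂(M.P x) := by simp
    have hr0 : 0 ≤ r ^ k := by positivity
    rw [hc]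
    refine integral_mono ((((hbound _ _).const_mul _).sub ((hbound F _).const_mul _)).indicator
      (hmeas' k)) (integrable_const _) fun ω => ?_
    by_cases hω : ((k * δ : ℝ≥0) : WithTop ℝ≥0) < σ ω
    · rw [indicator_of_mem]
      · have := mul_le_mul_of_nonneg_left (hδ _ (hD ω _ hω)) hr0
        simp only [pow_succ]
        linarith
      · exact hω
    · rw [indicator_of_notMem]
      · have : 0 ≤ ε * (r ^ k * (1 - r)) := by
          have := sub_nonneg.2 hr1
          positivity
        simpa [pow_succ, mul_sub] using this
      · exact hω
  have h0 : ∫ ω, M.discountedAt β F 0 ω ∂(M.P x) = F x := by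
    rw [integral_congr_ae (g := fun _ => F x)]
    · simp
    · filter_upwards [M.X_zero_ae x] with ω hω
      simp [discountedAt, hω]
  unfold gridStopped
  rw [integral_add (M.integrable_discountedAt hβ F 0 x) (integrable_finsetSum _ fun k _ => hint k),
    integral_finsetSum _ fun k _ => hint k, h0]
  gcongr
  calc _ ≤ ∑ k ∈ Finset.range N, ε * (r ^ k - r ^ (k + 1)) := Finset.sum_le_sum fun k _ => hstep k
    _ = ε * (1 - r ^ N) := by rw [← Finset.mul_sum, Finset.sum_range_sub', pow_zero]
    _ ≤ ε := by
      have : 0 ≤ r ^ N := by positivity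
      nlinarith

/-- Optional stopping for the discounted process: if `(Q - β)F ≤ 0` outside `D` and the chain does
not visit `D` before `σ`, then `E_x[e^{-βσ} F(X_σ)] ≤ F(x)`. -/
theorem integral_discounted_le (M : MarkovChain E Ω Q) {β : ℝ} (hβ : 0 < β) {F : E → ℝ}
    {σ : Ω → WithTop ℝ≥0} (hσ : M.IsStopping σ) {D : Set E}
    (hD : ∀ ω (s : ℝ≥0), (s : WithTop ℝ≥0) < σ ω → M.X s ω ∉ D)
    (hF : ∀ y ∉ D, genApply Q F y - β * F y ≤ 0) (x : E) :
    ∫ ω, M.discounted β F σ ω ∂(M.P x) ≤ F x := by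
  have := M.isProbabilityMeasure x
  refine le_of_forall_pos_le_add fun ε hε => ?_
  have hlim : Tendsto (fun n : ℕ => ∫ ω, M.gridStopped β F σ (mesh n) ((n + 1) ^ 2) ω ∂(M.P x))
      atTop (𝓝 (∫ ω, M.discounted β F σ ω ∂(M.P x))) :=
    tendsto_integral_of_dominated_convergence (fun _ => ∑ y, |F y|)
      (fun n => (M.measurable_gridStopped β F hσ _ _).aestronglyMeasurable) (integrable_const _)
      (fun n => ae_of_all _ fun ω => M.abs_gridStopped_le hβ F σ (mesh_pos n) _ ω)
      (ae_of_all _ (M.tendsto_gridStopped hβ F σ))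
  have hev : ∀ᶠ t : ℝ in 𝓝[>] 0, ∀ y ∉ D,
      Real.exp (-β * t) * M.transition t.toNNReal F y - F y ≤ ε * (1 - Real.exp (-β * t)) :=
    -- Finiteness of `E` gives one threshold on the mesh valid for all states.
    eventually_all.2 fun y => by
      by_cases hy : y ∈ D
      · exact Eventually.of_forall fun _ h => absurd hy h
      · filter_upwards [M.eventually_discounted_transition_le hβ F (hF y hy) hε] with t ht _
        exact ht
  refine le_of_tendsto hlim ((tendsto_mesh.eventually hev).mono fun n hn => ?_)
  exact M.integral_gridStopped_le hβ F hσ hD hε.le (by simpa using hn) _ x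

/-! ### The payoff -/

lemma integrable_payoff (M : MarkovChain E Ω Q) {β : ℝ} (hβ : 0 < β) (ψ φ : E → ℝ) (x : E)
    {τ γ : Ω → WithTop ℝ≥0} (hτ : M.IsStopping τ) (hγ : M.IsStopping γ) :
    Integrable (fun ω => open Classical in
      if τ ω ≤ γ ω then M.discounted β ψ τ ω else M.discounted β φ γ ω) (M.P x) := by
  classical
  have := M.isProbabilityMeasure x
  refine Integrable.of_bound (C := ∑ y, |ψ y| + ∑ y, |φ y|) ?_ (ae_of_all _ fun ω => ?_)
  · exact (Measurable.ite (measurableSet_le hτ.measurable' hγ.measurable')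
      (M.measurable_discounted hβ ψ hτ) (M.measurable_discounted hβ φ hγ)).aestronglyMeasurable
  · have h1 : 0 ≤ ∑ y, |ψ y| := Finset.sum_nonneg fun _ _ => abs_nonneg _
    have h2 : 0 ≤ ∑ y, |φ y| := Finset.sum_nonneg fun _ _ => abs_nonneg _
    rw [Real.norm_eq_abs]
    split_ifs
    · linarith [M.abs_discounted_le hβ ψ τ ω]
    · linarith [M.abs_discounted_le hβ φ γ ω]

lemma integrable_discounted (M : MarkovChain E Ω Q) {β : ℝ} (hβ : 0 < β) (F : E → ℝ) (x : E)
    {σ : Ω → WithTop ℝ≥0} (hσ : M.IsStopping σ) : Integrable (M.discounted β F σ) (M.P x) := by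
  have := M.isProbabilityMeasure x
  exact Integrable.of_bound (M.measurable_discounted hβ F hσ).aestronglyMeasurable _
    (ae_of_all _ (M.abs_discounted_le hβ F σ))

lemma discounted_min (M : MarkovChain E Ω Q) (β : ℝ) (F : E → ℝ) (τ γ : Ω → WithTop ℝ≥0) (ω : Ω) :
    M.discounted β F (fun ω => min (τ ω) (γ ω)) ω = open Classical in
      if τ ω ≤ γ ω then M.discounted β F τ ω else M.discounted β F γ ω := by
  classical
  split_ifs with h
  · simp [discounted, min_eq_left h]
  · simp [discounted, min_eq_right (not_le.1 h).le]

lemma discounted_mono (M : MarkovChain E Ω Q) (β : ℝ) {F G : E → ℝ} {σ : Ω → WithTop ℝ≥0} {ω : Ω}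
    (h : ∀ t : ℝ≥0, σ ω = t → F (M.X t ω) ≤ G (M.X t ω)) :
    M.discounted β F σ ω ≤ M.discounted β G σ ω := by
  unfold discounted
  split_ifs with hσ
  · rfl
  · obtain ⟨t, ht⟩ := WithTop.ne_top_iff_exists.1 hσ
    have := h t ht.symm
    rw [← ht, WithTop.untopD_coe]
    gcongr

lemma discounted_neg (M : MarkovChain E Ω Q) (β : ℝ) (F : E → ℝ) (σ : Ω → WithTop ℝ≥0) (ω : Ω) :
    M.discounted β (fun y => -F y) σ ω = -M.discounted β F σ ω := by
  unfold discounted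
  split_ifs <;> simp

/-- If `ψ ≤ W` everywhere, `φ ≤ W` on `D` and `(Q - β)W ≤ 0` off `D`, then hitting `D` holds the
payoff of the maximiser down to at most `W`. -/
theorem payoff_hit_right_le (M : MarkovChain E Ω Q) {β : ℝ} (hβ : 0 < β) {ψ φ W : E → ℝ}
    {D : Set E} (hψ : ∀ y, ψ y ≤ W y) (hφ : ∀ y ∈ D, φ y ≤ W y)
    (hW : ∀ y ∉ D, genApply Q W y - β * W y ≤ 0) (x : E) {τ : Ω → WithTop ℝ≥0}
    (hτ : M.IsStopping τ) : M.payoff β ψ φ x τ (M.hit D) ≤ W x := by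
  have hγ := M.isStopping_hit D
  have hσ : M.IsStopping fun ω => min (τ ω) (M.hit D ω) := hτ.min hγ
  refine le_trans (integral_mono (M.integrable_payoff hβ ψ φ x hτ hγ)
    (M.integrable_discounted hβ W x hσ) fun ω => ?_) (M.integral_discounted_le hβ hσ
      (fun ω s hs => M.X_notMem_of_lt_hit D (hs.trans_le (min_le_right _ _))) hW x)
  simp only [discounted_min]
  -- If `τ` comes first or ties, the reward is `ψ ≤ W`; otherwise the chain is stopped in `D`, where
  -- `φ ≤ W`.
  split_ifs
  · exact M.discounted_mono β fun t _ => hψ _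
  · exact M.discounted_mono β fun t ht => hφ _ (M.X_hit_mem D ht)

/-- If `W ≤ φ` everywhere, `W ≤ ψ` on `D` and `(Q - β)W ≥ 0` off `D`, then hitting `D` secures the
maximiser at least `W`. -/
theorem le_payoff_hit_left (M : MarkovChain E Ω Q) {β : ℝ} (hβ : 0 < β) {ψ φ W : E → ℝ}
    {D : Set E} (hφ : ∀ y, W y ≤ φ y) (hψ : ∀ y ∈ D, W y ≤ ψ y)
    (hW : ∀ y ∉ D, 0 ≤ genApply Q W y - β * W y) (x : E) {γ : Ω → WithTop ℝ≥0}
    (hγ : M.IsStopping γ) : W x ≤ M.payoff β ψ φ x (M.hit D) γ := by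
  have hτ := M.isStopping_hit D
  have hσ : M.IsStopping fun ω => min (M.hit D ω) (γ ω) := hτ.min hγ
  -- The submartingale case is the supermartingale case for `-W`.
  have hle := M.integral_discounted_le hβ (F := fun y => -W y) hσ
    (fun ω s hs => M.X_notMem_of_lt_hit D (hs.trans_le (min_le_left _ _)))
    (fun y hy => by
      have := hW y hy
      simp only [genApply, mul_neg, Finset.sum_neg_distrib] at this ⊢
      linarith) x
  simp only [discounted_neg, integral_neg] at hle
  refine (neg_le_neg_iff.1 hle).trans (integral_mono (M.integrable_discounted hβ W x hσ)
    (M.integrable_payoff hβ ψ φ x hτ hγ) fun ω => ?_)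
  simp only [discounted_min]
  split_ifs
  · exact M.discounted_mono β fun t ht => hψ _ (M.X_hit_mem D ht)
  · exact M.discounted_mono β fun t _ => hφ _

/-- Two strategies, each securing `W` against every reply, form a Nash equilibrium with value `W`. -/
theorem isNashEquilibrium_and_isValueFunction (M : MarkovChain E Ω Q) {β : ℝ} {ψ φ W : E → ℝ}
    {τ' γ' : Ω → WithTop ℝ≥0} (hτ' : M.IsStopping τ') (hγ' : M.IsStopping γ')
    (hle : ∀ x τ, M.IsStopping τ → M.payoff β ψ φ x τ γ' ≤ W x)
    (hge : ∀ x γ, M.IsStopping γ → W x ≤ M.payoff β ψ φ x τ' γ) :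
    M.IsNashEquilibrium β ψ φ τ' γ' ∧ M.IsValueFunction β ψ φ W := by
  refine ⟨⟨hτ', hγ', fun x τ γ hτ hγ => ⟨(hle x τ hτ).trans (hge x γ' hγ'),
    (hle x τ' hτ').trans (hge x γ hγ)⟩⟩, fun x => ?_⟩
  have hlow : (W x : EReal) ≤ M.lowerValue β ψ φ x :=
    le_iSup₂_of_le τ' hτ' (le_iInf₂ fun γ hγ => EReal.coe_le_coe_iff.2 (hge x γ hγ))
  have hup : M.upperValue β ψ φ x ≤ (W x : EReal) :=
    iInf₂_le_of_le γ' hγ' (iSup₂_le fun τ hτ => EReal.coe_le_coe_iff.2 (hle x τ hτ))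
  have hlu : M.lowerValue β ψ φ x ≤ M.upperValue β ψ φ x :=
    iSup₂_le fun τ hτ => le_iInf₂ fun γ hγ =>
      (iInf₂_le γ hγ).trans (le_iSup₂ (f := fun τ (_ : M.IsStopping τ) =>
        (M.payoff β ψ φ x τ γ : EReal)) τ hτ)
  exact ⟨(hlu.trans hup).antisymm hlow, hup.antisymm (hlow.trans hlu)⟩

end MarkovChain
end StoppingGame

end

theorem theorem2p4 {E Ω : Type*} [Fintype E] [TopologicalSpace E] [DiscreteTopology E]
    [MeasurableSpace E] [BorelSpace E] [MeasurableSpace Ω]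
    (Q : Matrix E E ℝ) (hQ : StoppingGame.IsMarkovGenerator Q)
    (M : StoppingGame.MarkovChain E Ω Q)
    (β : ℝ) (hβ : 0 < β)
    (ψ φ : E → ℝ) (hψ : ∀ x, 0 ≤ ψ x) (hψφ : ∀ x, ψ x ≤ φ x)
    (A B : Set E) (hAB : Disjoint A B)
    (hA : Disjoint A {x | φ x = ψ x}) (hB : Disjoint B {x | φ x = ψ x})
    (W : E → ℝ)
    (hWA : ∀ x ∈ A, StoppingGame.genApply Q W x - β * W x ≤ 0 ∧ W x = ψ x)
    (hWB : ∀ x ∈ B, 0 ≤ StoppingGame.genApply Q W x - β * W x ∧ W x = φ x)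
    (hW : ∀ x, x ∉ A ∪ B ∪ {x | φ x = ψ x} → StoppingGame.genApply Q W x - β * W x = 0)
    (hW_bounds : ∀ x, ψ x ≤ W x ∧ W x ≤ φ x) :
    M.IsNashEquilibrium β ψ φ
        (M.hit (A ∪ {x | φ x = ψ x})) (M.hit (B ∪ {x | φ x = ψ x})) ∧
      M.IsValueFunction β ψ φ W := by
  refine M.isNashEquilibrium_and_isValueFunction (M.isStopping_hit _) (M.isStopping_hit _)
    (fun x τ hτ => M.payoff_hit_right_le hβ (fun y => (hW_bounds y).1) ?_ ?_ x hτ)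
    (fun x γ hγ => M.le_payoff_hit_left hβ (fun y => (hW_bounds y).2) ?_ ?_ x hγ)
  · rintro y (hy | hy)
    · exact (hWB y hy).2.ge
    · exact (show φ y = ψ y from hy).trans_le (hW_bounds y).1
  · intro y hy
    -- Off `B ∪ {φ = ψ}`, the drift is nonpositive on `A` and zero elsewhere.
    by_cases hyA : y ∈ A
    · exact (hWA y hyA).1
    · exact (hW y fun h => by rcases h with (h | h) | h <;> simp_all).le
  · rintro y (hy | hy)
    · exact (hWA y hy).2.le
    · exact (hW_bounds y).2.trans_eq hy
  · intro y hy
    by_cases hyB : y ∈ B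
    · exact (hWB y hyB).1
    · exact (hW y fun h => by rcases h with (h | h) | h <;> simp_all).ge
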